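/- Let $p\ge 1$ and let $\mathbf a=(a_1,\dots,a_p)$ be a primitive tuple, that is, the $a_i$ are distinct positive integers with $\gcd(a_1,\dots,a_p)=1$. An independence system is a nonempty set $S\subseteq\{0,1\}^n$ such that $\mathbf x\in\{0,1\}^n$, $\mathbf x\le\mathbf y\in S$ implies $\mathbf x\in S$. A linear-optimization oracle for $S$, queried on $\mathbf c\in\mathbb Z^n$, returns some $\mathbf x\in S$ that maximizes $\mathbf c^\top\mathbf x$ over $S$. A comparison oracle for $f:\mathbb Z\to\mathbb R$, queried on $u,v\in\mathbb Z$, tells whether or not $f(u)\le f(v)$. For an integer $r\ge 0$, a vector $\mathbf x^*\in S$ is an $r$-best solution of $\min\{f(\mathbf w^\top\mathbf x):\mathbf x\in S\}$ if at most $r$ distinct real numbers smaller than $f(\mathbf w^\top\mathbf x^*)$ are of the form $f(\mathbf w^\top\mathbf y)$ with $\mathbf y\in S$; a $0$-best solution is optimal. The Frobenius number $\mathrm F(\mathbf a)$ is the largest integer that is not a nonnegative integer combination of the $a_i$ (so $\mathrm F(\mathbf a)=-1$ if some $a_i=1$). Then there are a constant $r(\mathbf a)$, a single algorithm and a polynomial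 $T$, all depending only on $\mathbf a$, such that the following holds for every $n\ge 0$, every independence system $S\subseteq\{0,1\}^n$ given by an arbitrary linear-optimization oracle, every weight vector $\mathbf w\in\{a_1,\dots,a_p\}^n$, and every function $f:\mathbb Z\to\mathbb R$ given by a comparison oracle: on input $n$ and $\mathbf w$, with access to the two oracles, the algorithm halts after at most $T(n)$ steps and outputs an $r(\mathbf a)$-best solution of $\min\{f(\mathbf w^\top\mathbf x):\mathbf x\in S\}$. Moreover, for the same algorithm: 1. if $a_i$ divides $a_{i+1}$ for $i=1,\dots,p-1$, then the output is an optimal solution; 2. if $p=2$, then the output is a $\max\{\mathrm F(\mathbf a),0\}$-best solution (that is, $\mathrm F(\mathbf a)$-best if $a_1,a_2\ge 2$, and optimal if $1\in\{a_1,a_2\}$). Here an algorithm is a fixed program of a random access machine with integer variables and integer arrays, whose operations are memory access (with computed array indices), integer addition and subtraction, sign tests, while loops and oracle queries. Each of these operations counts one step, except that a query to the linear-optimization oracle counts $2n+1$ steps. -/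

import Mathlib

/-! ### Independence systems, oracles and approximate solutions -/

/-- A tuple of distinct positive integers whose greatest common divisor is `1`. -/
structure IsPrimitiveTuple {p : ℕ} (a : Fin p → ℕ) : Prop where
  pos : ∀ i, 0 < a i
  injective : Function.Injective a
  gcd_eq_one : Finset.univ.gcd a = 1

/-- `a i` divides `a (i + 1)` for all consecutive indices. -/
def IsDivisibleTuple {p : ℕ} (a : Fin p → ℕ) : Prop :=
  ∀ i j : Fin p, (j : ℕ) = (i : ℕ) + 1 → a i ∣ a j

/-- `F` is the largest integer that is not a nonnegative integer combination of the `a i`.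
(It is an integer, because it equals `-1` when some `a i` is `1`.) -/
def IsFrobeniusNumber {p : ℕ} (a : Fin p → ℕ) (F : ℤ) : Prop :=
  IsGreatest {z : ℤ | ¬ ∃ c : Fin p → ℕ, z = ∑ i, (c i : ℤ) * (a i : ℤ)} F

/-- Vectors all of whose entries are `0` or `1`. -/
def IsZeroOne {n : ℕ} (x : Fin n → ℤ) : Prop :=
  ∀ j, x j = 0 ∨ x j = 1

/-- A nonempty set of `0/1`-vectors that is closed downwards among the `0/1`-vectors. -/
structure IsIndependenceSystem {n : ℕ} (S : Set (Fin n → ℤ)) : Prop where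
  nonempty : S.Nonempty
  zeroOne : ∀ x ∈ S, IsZeroOne x
  down_closed : ∀ x y : Fin n → ℤ, IsZeroOne x → x ≤ y → y ∈ S → x ∈ S

/-- Queried on `c`, the oracle returns an element of `S` that maximizes `c ⬝ᵥ x` over `S`. -/
def IsLinearOptimizationOracle {n : ℕ} (S : Set (Fin n → ℤ))
    (linOpt : (Fin n → ℤ) → (Fin n → ℤ)) : Prop :=
  ∀ c : Fin n → ℤ, linOpt c ∈ S ∧ ∀ y ∈ S, c ⬝ᵥ y ≤ c ⬝ᵥ linOpt c

/-- Queried on `u, v`, the oracle tells whether or not `f u ≤ f v`. -/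
def IsComparisonOracle (f : ℤ → ℝ) (cmp : ℤ → ℤ → Bool) : Prop :=
  ∀ u v : ℤ, cmp u v = true ↔ f u ≤ f v

/-- `x` is an `r`-best solution of `min {f (w ⬝ᵥ y) : y ∈ S}`: it is feasible, and at most `r`
better objective values are attained by feasible solutions. -/
def IsBestSolution {n : ℕ} (S : Set (Fin n → ℤ)) (w : Fin n → ℤ) (f : ℤ → ℝ) (r : ℕ)
    (x : Fin n → ℤ) : Prop :=
  x ∈ S ∧ {v : ℝ | v < f (w ⬝ᵥ x) ∧ ∃ y ∈ S, f (w ⬝ᵥ y) = v}.encard ≤ r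

/-! ### Algorithms: programs of a random access machine with two oracles

Programs are finite pieces of syntax, written in a structured language with integer variables
and integer arrays that can be indexed by computed values.  The only arithmetic is addition and
subtraction, at unit cost (multiplication would have to be programmed), so that in `t` steps the
bit lengths of the numbers grow by at most `t + O(1)`: polynomial time in this model is polynomial
time on Turing machines. -/

namespace OracleRAM

/-- The memory: integer variables, and arrays of integers, both named by natural numbers. -/
structure State where
  var : ℕ → ℤ
  arr : ℕ → ℤ → ℤ

/-- Integer expressions. -/
inductive Expr where
  | const (z : ℤ)
  | var (v : ℕ)
  | get (A : ℕ) (index : Expr)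
  | add (e₁ e₂ : Expr)
  | sub (e₁ e₂ : Expr)

/-- The value of an expression. -/
def Expr.eval (s : State) : Expr → ℤ
  | .const z => z
  | .var v => s.var v
  | .get A e => s.arr A (e.eval s)
  | .add e₁ e₂ => e₁.eval s + e₂.eval s
  | .sub e₁ e₂ => e₁.eval s - e₂.eval s

/-- The number of steps for evaluating an expression: one for every constant, memory access
and arithmetic operation. -/
def Expr.cost : Expr → ℕ
  | .const _ => 1
  | .var _ => 1
  | .get _ e => e.cost + 1
  | .add e₁ e₂ => e₁.cost + e₂.cost + 1
  | .sub e₁ e₂ => e₁.cost + e₂.cost + 1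

/-- Programs. -/
inductive Cmd where
  /-- do nothing -/
  | skip
  /-- `v := e` -/
  | assign (v : ℕ) (e : Expr)
  /-- `A[index] := e` -/
  | store (A : ℕ) (index e : Expr)
  /-- first `c`, then `d` -/
  | seq (c d : Cmd)
  /-- if `0 < e` then `c` else `d` -/
  | ite (e : Expr) (c d : Cmd)
  /-- while `0 < e` do `c` -/
  | loop (e : Expr) (c : Cmd)
  /-- query the linear-optimization oracle on the vector `A[0], …, A[n-1]` and write the answer
  to `B[0], …, B[n-1]` -/
  | optimize (A B : ℕ)
  /-- query the comparison oracle on the values of `e₁` and `e₂`, and set `v` to `1` if the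
  answer is yes and to `0` if it is no -/
  | compare (v : ℕ) (e₁ e₂ : Expr)

/-- The two oracles that a program can query. -/
structure Oracles (n : ℕ) where
  linOpt : (Fin n → ℤ) → (Fin n → ℤ)
  cmp : ℤ → ℤ → Bool

def State.setVar (s : State) (v : ℕ) (z : ℤ) : State where
  var := Function.update s.var v z
  arr := s.arr

def State.setCell (s : State) (A : ℕ) (i z : ℤ) : State where
  var := s.var
  arr := Function.update s.arr A (Function.update (s.arr A) i z)

/-- Overwrite the values of a function at the indices `0, …, n-1` by the vector `x`. -/
def overwrite {n : ℕ} (x : Fin n → ℤ) (g : ℤ → ℤ) : ℤ → ℤ := fun i =>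
  if h : 0 ≤ i ∧ i < (n : ℤ) then x ⟨i.toNat, (Int.toNat_lt h.1).2 h.2⟩ else g i

def State.setVec {n : ℕ} (s : State) (A : ℕ) (x : Fin n → ℤ) : State where
  var := s.var
  arr := Function.update s.arr A (overwrite x (s.arr A))

/-- The vector `A[0], …, A[n-1]`. -/
def State.getVec (s : State) (A n : ℕ) : Fin n → ℤ := fun j => s.arr A ((j : ℕ) : ℤ)

/-- `Exec O c s s' t`: with the oracles `O`, the program `c` started in memory `s` halts after
exactly `t` steps in memory `s'`.  A query to the linear-optimization oracle counts `2n + 1` steps,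
for writing the query, asking, and reading the answer. -/
inductive Exec {n : ℕ} (O : Oracles n) : Cmd → State → State → ℕ → Prop where
  | skip (s : State) : Exec O .skip s s 1
  | assign (s : State) (v : ℕ) (e : Expr) :
      Exec O (.assign v e) s (s.setVar v (e.eval s)) (e.cost + 1)
  | store (s : State) (A : ℕ) (i e : Expr) :
      Exec O (.store A i e) s (s.setCell A (i.eval s) (e.eval s)) (i.cost + e.cost + 1)
  | seq {c d : Cmd} {s s' s'' : State} {t t' : ℕ} :
      Exec O c s s' t → Exec O d s' s'' t' → Exec O (.seq c d) s s'' (t + t')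
  | ite_pos {e : Expr} {c d : Cmd} {s s' : State} {t : ℕ} :
      0 < e.eval s → Exec O c s s' t → Exec O (.ite e c d) s s' (e.cost + 1 + t)
  | ite_neg {e : Expr} {c d : Cmd} {s s' : State} {t : ℕ} :
      ¬ 0 < e.eval s → Exec O d s s' t → Exec O (.ite e c d) s s' (e.cost + 1 + t)
  | loop_stop {e : Expr} {c : Cmd} {s : State} :
      ¬ 0 < e.eval s → Exec O (.loop e c) s s (e.cost + 1)
  | loop_step {e : Expr} {c : Cmd} {s s' s'' : State} {t t' : ℕ} :
      0 < e.eval s → Exec O c s s' t → Exec O (.loop e c) s' s'' t' →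
        Exec O (.loop e c) s s'' (e.cost + 1 + t + t')
  | optimize (s : State) (A B : ℕ) :
      Exec O (.optimize A B) s (s.setVec B (O.linOpt (s.getVec A n))) (2 * n + 1)
  | compare (s : State) (v : ℕ) (e₁ e₂ : Expr) :
      Exec O (.compare v e₁ e₂) s
        (s.setVar v (if O.cmp (e₁.eval s) (e₂.eval s) = true then 1 else 0))
        (e₁.cost + e₂.cost + 1)

/-- The input: variable `0` holds `n`, array `0` holds the vector `w`, and everything else is
`0`. -/
def input {n : ℕ} (w : Fin n → ℤ) : State where
  var := fun v => if v = 0 then (n : ℤ) else 0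
  arr := fun A => if A = 0 then overwrite w (fun _ => 0) else fun _ => 0

/-- The output: the vector in the first `n` cells of array `1`. -/
def output (n : ℕ) (s : State) : Fin n → ℤ := s.getVec 1 n

end OracleRAM

/-! Let A be the largest of the a_i, and group the coordinates into classes by weight. Classify the
feasible y by the pattern τ of their class counts truncated at A; let I be the set of saturated
classes, those with τ_i = A, and let W be the weight inside I. Among the y of pattern τ choose y₀
with W maximal, and force τ_i elements of y₀ from every class i: at most pA coordinates J. Let x
maximize W over the feasible points containing J; one oracle query finds x if the coordinates in J
get a large extra weight (`mem_optimum_of_forced`). Deleting elements of x keeps it feasible and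
realizes all smaller class counts.

For y of pattern τ, the difference z = W(x) - W(y) is nonnegative and divisible by the gcd of the
a_i with i in I. If z is a nonnegative combination of these a_i, then an exchange argument
(`exists_bounded_combination`) makes its coefficients fit into the class counts of x, because x and
y both have at least A elements in every saturated class. Deleting elements of x then gives exactly
the value of y. Otherwise z is a gap of a numerical semigroup, and the value of y is v - z, where v
depends only on τ (`exists_isGuess_or_gap`). Hence, whatever f is, the candidates miss at most
`totalGaps` better values. Under divisibility there are no gaps; for p = 2 only the fully saturated
pattern has any.

The pattern and y₀ are unknown, but I, J and the deletions (one threshold per class) are described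
by 2(A+1) + pA numbers in 0, …, n. The program tries all of them (`exec_enum`), which is polynomial
for fixed a. -/

namespace OracleRAM

variable {n : ℕ} {O : Oracles n}

/-! ### Programs -/

/-- Run `c` with the variable `1` set to `0, …, n - 1`, where `n` is the variable `0`. -/
def forLoop (c : Cmd) : Cmd :=
  .seq (.assign 1 (.const 0))
    (.loop (.sub (.var 0) (.var 1)) (.seq c (.assign 1 (.add (.var 1) (.const 1)))))

/-- Run `c` for all contents of the cells `0, …, d - 1` of array `2` with values in
`0, …, n`. -/
def enum (c : Cmd) : ℕ → Cmd
  | 0 => c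
  | d + 1 => .seq (.store 2 (.const d) (.const 0))
      (.loop (.sub (.add (.var 0) (.const 1)) (.get 2 (.const d)))
        (.seq (enum c d) (.store 2 (.const d) (.add (.get 2 (.const d)) (.const 1)))))

/-- An expression for `A * n + 1`. -/
def bigExpr : ℕ → Expr
  | 0 => .const 1
  | A + 1 => .add (.var 0) (bigExpr A)

/-- Write the weights of the classes selected in array `2` to array `3`. -/
def fillCmd : Cmd :=
  forLoop (.ite (.get 2 (.get 0 (.var 1)))
    (.store 3 (.var 1) (.get 0 (.var 1))) (.store 3 (.var 1) (.const 0)))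

/-- Add a large number to the cells of array `3` that are listed in the cells
`b, …, b + k - 1` of array `2`. -/
def forceCmd (A b : ℕ) : ℕ → Cmd
  | 0 => .skip
  | k + 1 => .seq (forceCmd A b k)
      (.store 3 (.get 2 (.const (b + k)))
        (.add (.get 3 (.get 2 (.const (b + k)))) (bigExpr A)))

/-- Write to array `5` the part of the vector in array `4` that lies below the thresholds given
from cell `b` of array `2` on, and write its weight to the variable `2`. -/
def selectCmd (b : ℕ) : Cmd :=
  .seq (.assign 2 (.const 0))
    (forLoop (.ite (.get 4 (.var 1))
      (.ite (.sub (.get 2 (.add (.get 0 (.var 1)) (.const b))) (.var 1))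
        (.seq (.store 5 (.var 1) (.const 1)) (.assign 2 (.add (.var 2) (.get 0 (.var 1)))))
        (.store 5 (.var 1) (.const 0)))
      (.store 5 (.var 1) (.const 0))))

/-- Replace the best known vector by the one in array `5` if that is better. -/
def updateCmd : Cmd :=
  .seq (.compare 3 (.var 4) (.var 2))
    (.ite (.var 3) .skip
      (.seq (.assign 4 (.var 2)) (forLoop (.store 1 (.var 1) (.get 5 (.var 1))))))

/-- The treatment of one content of array `2`. -/
def tryCmd (A K : ℕ) : Cmd :=
  .seq fillCmd (.seq (forceCmd A (2 * (A + 1)) K)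
    (.seq (.optimize 3 4) (.seq (selectCmd (A + 1)) updateCmd)))

/-! ### Their execution -/

theorem exec_loop_count {e : Expr} {c : Cmd} {B N : ℕ} (I : ℕ → State → Prop)
    (he : ∀ k ≤ N, ∀ s, I k s → e.eval s = (N : ℤ) - k)
    (hc : ∀ k < N, ∀ s, I k s → ∃ s' t, Exec O c s s' t ∧ t ≤ B ∧ I (k + 1) s')
    (s : State) (h0 : I 0 s) :
    ∃ s' t, Exec O (.loop e c) s s' t ∧ t ≤ N * (e.cost + 1 + B) + (e.cost + 1) ∧ I N s' := by
  suffices H : ∀ m k s, k + m = N → I k s → ∃ s' t, Exec O (.loop e c) s s' t ∧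
      t ≤ m * (e.cost + 1 + B) + (e.cost + 1) ∧ I N s' from H N 0 s (by simp) h0
  intro m
  induction m with
  | zero =>
    intro k s hk hs
    obtain rfl : k = N := by simpa using hk
    exact ⟨s, _, Exec.loop_stop (by rw [he k le_rfl s hs]; simp), by simp, hs⟩
  | succ m ih =>
    intro k s hk hs
    obtain ⟨s₁, t₁, h₁, ht₁, hI₁⟩ := hc k (by omega) s hs
    obtain ⟨s₂, t₂, h₂, ht₂, hI₂⟩ := ih (k + 1) s₁ (by omega) hI₁
    refine ⟨s₂, _, .loop_step (by rw [he k (by omega) s hs]; omega) h₁ h₂, ?_, hI₂⟩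
    rw [Nat.succ_mul]
    omega

theorem exec_forLoop {c : Cmd} {B : ℕ} (I : ℕ → State → Prop) (s : State)
    (hn : s.var 0 = n) (h0 : I 0 (s.setVar 1 0))
    (hc : ∀ k < n, ∀ s : State, s.var 0 = n → s.var 1 = k → I k s →
      ∃ s' t, Exec O c s s' t ∧ t ≤ B ∧ s'.var 0 = n ∧ s'.var 1 = k ∧
        I (k + 1) (s'.setVar 1 (k + 1))) :
    ∃ s' t, Exec O (forLoop c) s s' t ∧ t ≤ n * (B + 8) + 6 ∧ s'.var 0 = n ∧ I n s' := by
  obtain ⟨s', t, h, ht, hI⟩ := exec_loop_count (O := O) (N := n) (B := B + 4)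
    (e := .sub (.var 0) (.var 1)) (c := .seq c (.assign 1 (.add (.var 1) (.const 1))))
    (fun k s => s.var 0 = n ∧ s.var 1 = k ∧ I k s)
    (by rintro k - s ⟨h₁, h₂, -⟩; simp [Expr.eval, h₁, h₂])
    (by
      rintro k hk s ⟨h₁, h₂, h₃⟩
      obtain ⟨s', t, h, ht, h₁', h₂', h₃'⟩ := hc k hk s h₁ h₂ h₃
      refine ⟨_, _, .seq h (.assign _ _ _), by simp only [Expr.cost]; omega, ?_, ?_, ?_⟩
      · simpa [State.setVar] using h₁'
      · simp [State.setVar, Expr.eval, h₂']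
      · simpa [Expr.eval, h₂'] using h₃')
    (s.setVar 1 0) ⟨by simpa [State.setVar] using hn, by simp [State.setVar], h0⟩
  refine ⟨s', _, .seq (.assign s 1 (.const 0)) h, ?_, hI.1, hI.2.2⟩
  simp only [Expr.cost] at ht ⊢
  have : n * (1 + 1 + 1 + 1 + (B + 4)) = n * (B + 8) := by ring
  omega

theorem eval_bigExpr (s : State) (A : ℕ) : (bigExpr A).eval s = A * s.var 0 + 1 := by
  induction A with
  | zero => simp [bigExpr, Expr.eval]
  | succ A ih => simp [bigExpr, Expr.eval, ih]; ring

theorem cost_bigExpr (A : ℕ) : (bigExpr A).cost = 2 * A + 1 := by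
  induction A with
  | zero => simp [bigExpr, Expr.cost]
  | succ A ih => simp [bigExpr, Expr.cost, ih]; ring

theorem exec_fillCmd (s : State) (hn : s.var 0 = n) :
    ∃ s' t, Exec O fillCmd s s' t ∧ t ≤ n * 17 + 6 ∧ s'.var 0 = n ∧ s'.var 4 = s.var 4 ∧
      (∀ A, A ≠ 3 → s'.arr A = s.arr A) ∧
      ∀ i : ℕ, i < n → s'.arr 3 i = if 0 < s.arr 2 (s.arr 0 i) then s.arr 0 i else 0 := by
  obtain ⟨s', t, h, ht, h0, h4, h5, h6⟩ := exec_forLoop (O := O) (B := 9)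
    (c := .ite (.get 2 (.get 0 (.var 1)))
      (.store 3 (.var 1) (.get 0 (.var 1))) (.store 3 (.var 1) (.const 0)))
    (fun k s' => s'.var 4 = s.var 4 ∧ (∀ A, A ≠ 3 → s'.arr A = s.arr A) ∧
      ∀ i : ℕ, i < k → s'.arr 3 i = if 0 < s.arr 2 (s.arr 0 i) then s.arr 0 i else 0)
    s hn (by simp [State.setVar])
    (by
      rintro k hk s₁ h0 h1 ⟨h4, h5, h6⟩
      by_cases hpos : 0 < s.arr 2 (s.arr 0 k)
      · refine ⟨_, _, .ite_pos ?_ (.store _ _ _ _), by simp [Expr.cost], ?_, ?_, ?_, ?_, ?_⟩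
        · simpa [Expr.eval, h1, h5] using hpos
        · simpa [State.setCell] using h0
        · simpa [State.setCell] using h1
        · simpa [State.setCell, State.setVar] using h4
        · intro A hA
          simpa [State.setCell, State.setVar, hA] using h5 A hA
        · intro i hi
          rcases Nat.lt_succ_iff_lt_or_eq.1 hi with hi | rfl
          · simp [State.setCell, State.setVar, h1, Expr.eval, hi.ne, h6 i hi]
          · simp [State.setCell, State.setVar, h1, Expr.eval, h5, hpos]
      · refine ⟨_, _, .ite_neg ?_ (.store _ _ _ _), by simp [Expr.cost], ?_, ?_, ?_, ?_, ?_⟩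
        · simpa [Expr.eval, h1, h5] using hpos
        · simpa [State.setCell] using h0
        · simpa [State.setCell] using h1
        · simpa [State.setCell, State.setVar] using h4
        · intro A hA
          simpa [State.setCell, State.setVar, hA] using h5 A hA
        · intro i hi
          rcases Nat.lt_succ_iff_lt_or_eq.1 hi with hi | rfl
          · simp [State.setCell, State.setVar, h1, Expr.eval, hi.ne, h6 i hi]
          · simp [State.setCell, State.setVar, h1, Expr.eval, hpos])
  exact ⟨s', t, h, ht, h0, h4, h5, h6⟩

theorem exec_forceCmd (A b k : ℕ) (s : State) (hn : s.var 0 = n) :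
    ∃ s' t, Exec O (forceCmd A b k) s s' t ∧ t ≤ k * (2 * A + 8) + 1 ∧
      s'.var = s.var ∧ (∀ B, B ≠ 3 → s'.arr B = s.arr B) ∧
      ∀ i, s'.arr 3 i = s.arr 3 i +
        ∑ l ∈ Finset.range k, if s.arr 2 (b + l) = i then (A * n + 1 : ℤ) else 0 := by
  induction k with
  | zero => exact ⟨s, 1, .skip s, by simp, rfl, fun _ _ => rfl, by simp⟩
  | succ k ih =>
    obtain ⟨s', t, h, ht, h1, h2, h3⟩ := ih
    refine ⟨_, _, .seq h (.store _ _ _ _), ?_, ?_, ?_, ?_⟩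
    · simp only [Expr.cost, cost_bigExpr, add_one_mul]
      omega
    · simpa [State.setCell] using h1
    · intro B hB
      simpa [State.setCell, hB] using h2 B hB
    · intro i
      rw [Finset.sum_range_succ]
      by_cases hi : s.arr 2 (b + k) = i
      · subst hi
        simp [State.setCell, Expr.eval, h2, h3, eval_bigExpr, h1, hn, add_assoc]
      · simp [State.setCell, Expr.eval, h2, h3, hi, Ne.symm hi]

theorem exec_selectCmd (b : ℕ) (s : State) (hn : s.var 0 = n) :
    ∃ s' t, Exec O (selectCmd b) s s' t ∧ t ≤ n * 29 + 8 ∧ s'.var 0 = n ∧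
      s'.var 4 = s.var 4 ∧ (∀ A, A ≠ 5 → s'.arr A = s.arr A) ∧
      (∀ i : ℕ, i < n → s'.arr 5 i =
        if 0 < s.arr 4 i ∧ 0 < s.arr 2 (s.arr 0 i + b) - i then 1 else 0) ∧
      s'.var 2 = ∑ i ∈ Finset.range n,
        s.arr 0 i * if 0 < s.arr 4 i ∧ 0 < s.arr 2 (s.arr 0 i + b) - i then 1 else 0 := by
  obtain ⟨s', t, h, ht, h0, h4, h5, h6, h7⟩ := exec_forLoop (O := O) (B := 21)
    (c := .ite (.get 4 (.var 1))
      (.ite (.sub (.get 2 (.add (.get 0 (.var 1)) (.const b))) (.var 1))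
        (.seq (.store 5 (.var 1) (.const 1)) (.assign 2 (.add (.var 2) (.get 0 (.var 1)))))
        (.store 5 (.var 1) (.const 0)))
      (.store 5 (.var 1) (.const 0)))
    (fun k s' => s'.var 4 = s.var 4 ∧ (∀ A, A ≠ 5 → s'.arr A = s.arr A) ∧
      (∀ i : ℕ, i < k → s'.arr 5 i =
        if 0 < s.arr 4 i ∧ 0 < s.arr 2 (s.arr 0 i + b) - i then 1 else 0) ∧
      s'.var 2 = ∑ i ∈ Finset.range k,
        s.arr 0 i * if 0 < s.arr 4 i ∧ 0 < s.arr 2 (s.arr 0 i + b) - i then 1 else 0)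
    (s.setVar 2 0) (by simpa [State.setVar] using hn) (by simp [State.setVar])
    (by
      rintro k hk s₁ h0 h1 ⟨h4, h5, h6, h7⟩
      have skipCase : ¬ (0 < s.arr 4 k ∧ 0 < s.arr 2 (s.arr 0 k + b) - k) →
          ((s₁.setCell 5 k 0).var 0 = n ∧ (s₁.setCell 5 k 0).var 1 = k ∧
          ((s₁.setCell 5 k 0).setVar 1 (k + 1)).var 4 = s.var 4 ∧
          (∀ A, A ≠ 5 → ((s₁.setCell 5 k 0).setVar 1 (k + 1)).arr A = s.arr A) ∧
          (∀ i : ℕ, i < k + 1 → ((s₁.setCell 5 k 0).setVar 1 (k + 1)).arr 5 i =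
            if 0 < s.arr 4 i ∧ 0 < s.arr 2 (s.arr 0 i + b) - i then 1 else 0) ∧
          ((s₁.setCell 5 k 0).setVar 1 (k + 1)).var 2 = ∑ i ∈ Finset.range (k + 1),
            s.arr 0 i * if 0 < s.arr 4 i ∧ 0 < s.arr 2 (s.arr 0 i + b) - i then 1 else 0) := by
        intro hneg
        refine ⟨h0, h1, by simpa [State.setCell, State.setVar] using h4, ?_, ?_, ?_⟩
        · intro A hA
          simpa [State.setCell, State.setVar, hA] using h5 A hA
        · intro i hi
          rcases Nat.lt_succ_iff_lt_or_eq.1 hi with hi | rfl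
          · simpa [State.setCell, State.setVar, hi.ne] using h6 i hi
          · rw [if_neg hneg]; simp [State.setCell, State.setVar]
        · rw [Finset.sum_range_succ, if_neg hneg]
          simpa [State.setCell, State.setVar] using h7
      have skipExec : Exec O (.store 5 (.var 1) (.const 0)) s₁ (s₁.setCell 5 k 0) 3 := by
        simpa [Expr.eval, Expr.cost, h1] using Exec.store (O := O) s₁ 5 (.var 1) (.const 0)
      by_cases hx : 0 < s.arr 4 k
      · by_cases hg : 0 < s.arr 2 (s.arr 0 k + b) - k
        · refine ⟨_, _, .ite_pos ?_ (.ite_pos ?_ (.seq (.store _ _ _ _) (.assign _ _ _))),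
            by simp [Expr.cost], ?_, ?_, ?_, ?_, ?_, ?_⟩
          · simpa [Expr.eval, h1, h5] using hx
          · simpa [Expr.eval, h1, h5] using hg
          · simpa [State.setCell, State.setVar] using h0
          · simpa [State.setCell, State.setVar] using h1
          · simpa [State.setCell, State.setVar] using h4
          · intro A hA
            simpa [State.setCell, State.setVar, hA] using h5 A hA
          · intro i hi
            rcases Nat.lt_succ_iff_lt_or_eq.1 hi with hi | rfl
            · simpa [State.setCell, State.setVar, h1, Expr.eval, hi.ne] using h6 i hi
            · rw [if_pos ⟨hx, hg⟩]
              simp [State.setCell, State.setVar, h1, Expr.eval]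
          · rw [Finset.sum_range_succ, if_pos ⟨hx, hg⟩, ← h7]
            simp [State.setCell, State.setVar, h1, Expr.eval, h5]
        · refine ⟨s₁.setCell 5 k 0, _, .ite_pos ?_ (.ite_neg ?_ skipExec), by simp [Expr.cost],
            skipCase fun h => hg h.2⟩
          · simpa [Expr.eval, h1, h5] using hx
          · simpa [Expr.eval, h1, h5] using hg
      · refine ⟨s₁.setCell 5 k 0, _, .ite_neg ?_ skipExec, by simp [Expr.cost],
          skipCase fun h => hx h.1⟩
        simpa [Expr.eval, h1, h5] using hx)
  refine ⟨s', _, .seq (.assign _ _ _) h, ?_, h0, h4, h5, h6, h7⟩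
  simp only [Expr.cost]
  omega

theorem exec_copy (s : State) (hn : s.var 0 = n) :
    ∃ s' t, Exec O (forLoop (.store 1 (.var 1) (.get 5 (.var 1)))) s s' t ∧
      t ≤ n * 12 + 6 ∧ s'.var 0 = n ∧ s'.var 4 = s.var 4 ∧
      (∀ A, A ≠ 1 → s'.arr A = s.arr A) ∧ ∀ i : ℕ, i < n → s'.arr 1 i = s.arr 5 i := by
  obtain ⟨s', t, h, ht, h0, h4, h5, h6⟩ := exec_forLoop (O := O) (B := 4)
    (c := .store 1 (.var 1) (.get 5 (.var 1)))
    (fun k s' => s'.var 4 = s.var 4 ∧ (∀ A, A ≠ 1 → s'.arr A = s.arr A) ∧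
      ∀ i : ℕ, i < k → s'.arr 1 i = s.arr 5 i)
    s hn (by simp [State.setVar])
    (by
      rintro k hk s₁ h0 h1 ⟨h4, h5, h6⟩
      refine ⟨_, _, .store _ _ _ _, by simp [Expr.cost], ?_, ?_, ?_, ?_, ?_⟩
      · simpa [State.setCell] using h0
      · simpa [State.setCell] using h1
      · simpa [State.setCell, State.setVar] using h4
      · intro A hA
        simpa [State.setCell, State.setVar, hA] using h5 A hA
      · intro i hi
        rcases Nat.lt_succ_iff_lt_or_eq.1 hi with hi | rfl
        · simp [State.setCell, State.setVar, h1, Expr.eval, hi.ne, h6 i hi]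
        · simp [State.setCell, State.setVar, h1, Expr.eval, h5])
  exact ⟨s', t, h, ht, h0, h4, h5, h6⟩

theorem exec_updateCmd (s : State) (hn : s.var 0 = n) :
    ∃ s' t, Exec O updateCmd s s' t ∧ t ≤ n * 12 + 13 ∧ s'.var 0 = n ∧
      (∀ A, A ≠ 1 → s'.arr A = s.arr A) ∧
      ((O.cmp (s.var 4) (s.var 2) = true ∧ s'.var 4 = s.var 4 ∧ s'.arr 1 = s.arr 1) ∨
      (O.cmp (s.var 4) (s.var 2) ≠ true ∧ s'.var 4 = s.var 2 ∧
        ∀ i : ℕ, i < n → s'.arr 1 i = s.arr 5 i)) := by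
  by_cases hc : O.cmp (s.var 4) (s.var 2) = true
  · refine ⟨_, _, .seq (.compare _ _ _ _) (.ite_pos ?_ (.skip _)), ?_, ?_, ?_, ?_⟩
    · simp [Expr.eval, State.setVar, hc]
    · simp only [Expr.cost]; omega
    · simpa [State.setVar] using hn
    · intro A hA
      rfl
    · exact .inl ⟨hc, by simp [State.setVar], rfl⟩
  · obtain ⟨s', t, h, ht, h0, h4, h5, h6⟩ := exec_copy (O := O)
      ((s.setVar 3 0).setVar 4 (s.var 2)) (by simpa [State.setVar] using hn)
    refine ⟨s', _, .seq (.compare _ _ _ _) (.ite_neg ?_ (.seq (.assign _ _ _) (t' := t) ?_)),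
      ?_, h0, h5, .inr ⟨hc, ?_, h6⟩⟩
    · simp [Expr.eval, State.setVar, hc]
    · simpa [Expr.eval, State.setVar, hc] using h
    · simp only [Expr.cost]; omega
    · simpa [State.setVar] using h4

/-! ### The candidate computed from one guess -/

/-- The vector on which the optimization oracle is queried. -/
def query (A K : ℕ) (w : Fin n → ℤ) (g : ℤ → ℤ) : Fin n → ℤ := fun j =>
  (if 0 < g (w j) then w j else 0) +
    ∑ l ∈ Finset.range K, if g ((2 * (A + 1) : ℕ) + l) = (j : ℕ) then (A * n + 1 : ℤ) else 0

/-- The part of `x` below the thresholds `g (w j + (A + 1))`. -/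
def cut (A : ℕ) (w : Fin n → ℤ) (g : ℤ → ℤ) (x : Fin n → ℤ) : Fin n → ℤ := fun j =>
  if 0 < x j ∧ 0 < g (w j + (A + 1 : ℕ)) - (j : ℕ) then 1 else 0

/-- The feasible point obtained from the content `g` of array `2`. -/
def candidate (O : Oracles n) (A K : ℕ) (w : Fin n → ℤ) (g : ℤ → ℤ) : Fin n → ℤ :=
  cut A w g (O.linOpt (query A K w g))

theorem overwrite_coe (x : Fin n → ℤ) (h : ℤ → ℤ) (j : Fin n) :
    overwrite x h (j : ℕ) = x j := by
  simp [overwrite]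

theorem exec_tryCmd (A K : ℕ) (s : State) (hn : s.var 0 = n) (w : Fin n → ℤ)
    (hw : s.getVec 0 n = w) :
    ∃ s' t, Exec O (tryCmd A K) s s' t ∧ t ≤ n * 60 + K * (2 * A + 8) + 29 ∧
      s'.var 0 = n ∧ s'.getVec 0 n = w ∧ s'.arr 2 = s.arr 2 ∧
      ((O.cmp (s.var 4) (w ⬝ᵥ candidate O A K w (s.arr 2)) = true ∧ s'.var 4 = s.var 4 ∧
        output n s' = output n s) ∨
      (O.cmp (s.var 4) (w ⬝ᵥ candidate O A K w (s.arr 2)) ≠ true ∧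
        s'.var 4 = w ⬝ᵥ candidate O A K w (s.arr 2) ∧
        output n s' = candidate O A K w (s.arr 2))) := by
  have hw' : ∀ j : Fin n, s.arr 0 (j : ℕ) = w j := fun j => congrFun hw j
  obtain ⟨s₁, t₁, e₁, l₁, n₁, v₁, a₁, c₁⟩ := exec_fillCmd (O := O) s hn
  obtain ⟨s₂, t₂, e₂, l₂, v₂, a₂, c₂⟩ := exec_forceCmd (O := O) A (2 * (A + 1)) K s₁ n₁
  have hq : s₂.getVec 3 n = query A K w (s.arr 2) := by
    funext j
    rw [State.getVec, c₂, c₁ j j.2, a₁ 2 (by decide), hw', query]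
  have e₃ := Exec.optimize (O := O) s₂ 3 4
  rw [hq] at e₃
  set x := O.linOpt (query A K w (s.arr 2)) with hx
  obtain ⟨s₄, t₄, e₄, l₄, n₄, v₄, a₄, c₄, u₄⟩ := exec_selectCmd (O := O) (A + 1)
    (s₂.setVec 4 x) (by simp [State.setVec, v₂, n₁])
  have harr : ∀ B, B ≠ 3 → B ≠ 4 → (s₂.setVec 4 x).arr B = s.arr B := by
    intro B h3 h4
    simp only [State.setVec, Function.update_of_ne h4, a₂ B h3, a₁ B h3]
  have hz : ∀ j : Fin n, (if 0 < (s₂.setVec 4 x).arr 4 (j : ℕ) ∧ 0 < (s₂.setVec 4 x).arr 2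
      ((s₂.setVec 4 x).arr 0 (j : ℕ) + (A + 1 : ℕ)) - (j : ℕ) then (1 : ℤ) else 0) =
      candidate O A K w (s.arr 2) j := by
    intro j
    rw [harr 2 (by decide) (by decide), harr 0 (by decide) (by decide), hw', candidate, cut]
    simp only [State.setVec, Function.update_self, overwrite_coe, hx]
  have hu : s₄.var 2 = w ⬝ᵥ candidate O A K w (s.arr 2) := by
    rw [u₄, Finset.sum_range, dotProduct]
    refine Finset.sum_congr rfl fun j _ => ?_
    rw [hz, harr 0 (by decide) (by decide), hw']
  have hv : s₄.var 4 = s.var 4 := by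
    rw [v₄, ← v₁, ← v₂]; rfl
  obtain ⟨s₅, t₅, e₅, l₅, n₅, a₅, c₅⟩ := exec_updateCmd (O := O) s₄ n₄
  rw [hu, hv] at c₅
  -- The coefficient of n is 17 + 2 + 29 + 12 for filling, querying, selecting and updating; forcing
  -- contributes the term with K.
  refine ⟨s₅, _, .seq e₁ (.seq e₂ (.seq e₃ (.seq e₄ e₅))), by omega, n₅, ?_, ?_, ?_⟩
  · funext j
    rw [State.getVec, a₅ 0 (by decide), a₄ 0 (by decide), harr 0 (by decide) (by decide), hw']
  · rw [a₅ 2 (by decide), a₄ 2 (by decide), harr 2 (by decide) (by decide)]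
  · refine c₅.imp (fun h => ⟨h.1, h.2.1, ?_⟩) (fun h => ⟨h.1, h.2.1, ?_⟩)
    · funext j
      rw [output, State.getVec, h.2.2, a₄ 1 (by decide), harr 1 (by decide) (by decide)]
      rfl
    · funext j
      rw [output, State.getVec, h.2.2 j j.2, c₄ j j.2, hz]

/-! ### Exhaustive enumeration of the guesses -/

/-- A bound for the running time of `enum`. -/
noncomputable def enumBound (B : Polynomial ℕ) : ℕ → Polynomial ℕ
  | 0 => B
  | d + 1 => (.X + 1) * (enumBound B d + 13) + 10

/-- `C g s` is meant as "the content g has already been accounted for in memory s". It has to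
survive later runs of the body and changes of array 2, so that it holds for all g at once in the
end. -/
theorem exec_enum {c : Cmd} {B : Polynomial ℕ} (I : State → Prop) (C : (ℤ → ℤ) → State → Prop)
    (hI : ∀ s, I s → s.var 0 = n)
    (hstore : ∀ s i z, I s → I (s.setCell 2 i z))
    (hCstore : ∀ g s i z, C g s → C g (s.setCell 2 i z))
    (hc : ∀ s, I s → ∃ s' t, Exec O c s s' t ∧ t ≤ B.eval n ∧ I s' ∧ s'.arr 2 = s.arr 2 ∧
      C (s.arr 2) s' ∧ ∀ g, C g s → C g s')
    (d : ℕ) (s : State) (hs : I s) :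
    ∃ s' t, Exec O (enum c d) s s' t ∧ t ≤ (enumBound B d).eval n ∧ I s' ∧
      (∀ i : ℤ, ¬ (0 ≤ i ∧ i < d) → s'.arr 2 i = s.arr 2 i) ∧
      (∀ g, (∀ i : ℤ, ¬ (0 ≤ i ∧ i < d) → g i = s.arr 2 i) →
        (∀ i : ℤ, 0 ≤ i → i < d → 0 ≤ g i ∧ g i ≤ (n : ℤ)) → C g s') ∧
      ∀ g, C g s → C g s' := by
  induction d generalizing s with
  | zero =>
    obtain ⟨s', t, h, ht, h1, h2, h3, h4⟩ := hc s hs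
    refine ⟨s', t, h, ht, h1, fun _ _ => by rw [h2], fun g hg _ => ?_, h4⟩
    obtain rfl : g = s.arr 2 := funext fun i => hg i (by push_cast; omega)
    exact h3
  | succ d ih =>
    obtain ⟨s', t, h, ht, h1, h2, h3, h4, h5⟩ := exec_loop_count (O := O) (N := n + 1)
      (B := (enumBound B d).eval n + 6)
      (e := .sub (.add (.var 0) (.const 1)) (.get 2 (.const d)))
      (c := .seq (enum c d) (.store 2 (.const d) (.add (.get 2 (.const d)) (.const 1))))
      (fun k s' => I s' ∧ s'.arr 2 d = k ∧
        (∀ i : ℤ, ¬ (0 ≤ i ∧ i < d + 1) → s'.arr 2 i = s.arr 2 i) ∧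
        (∀ g, (∀ i : ℤ, ¬ (0 ≤ i ∧ i < d + 1) → g i = s.arr 2 i) →
          (∀ i : ℤ, 0 ≤ i → i < d + 1 → 0 ≤ g i ∧ g i ≤ (n : ℤ)) → g d < (k : ℤ) → C g s') ∧
        ∀ g, C g s → C g s')
      (by
        rintro k - s₁ ⟨h1, h2, -⟩
        simp [Expr.eval, h2, hI _ h1])
      (by
        rintro k hk s₁ ⟨h1, h2, h3, h4, h5⟩
        obtain ⟨s₂, t, h, ht, j1, j2, j3, j4⟩ := ih s₁ h1
        have hd : s₂.arr 2 d = k := by rw [j2 d (by omega), h2]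
        refine ⟨_, _, .seq h (.store _ _ _ _), ?_, hstore _ _ _ j1, ?_, ?_, ?_, ?_⟩
        · simp only [Expr.cost]; omega
        · simp [State.setCell, Expr.eval, hd]
        · intro i hi
          have hid : i ≠ d := by omega
          simp only [State.setCell, Expr.eval, Function.update_self, Function.update_of_ne hid]
          rw [j2 i (by omega), h3 i hi]
        · intro g hg1 hg2 hg3
          refine hCstore _ _ _ _ ?_
          -- Contents with g d < k were treated in earlier passes; the new ones have g d = k, the
          -- present value of the cell.
          by_cases hgk : g d < k
          · exact j4 _ (h4 g hg1 hg2 hgk)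
          · refine j3 g (fun i hi => ?_) (fun i hi hi' => hg2 i hi (by omega))
            by_cases hid : i = d
            · subst hid
              rw [h2]; push_cast at hg3; omega
            · rw [hg1 i (by omega), h3 i (by omega)]
        · exact fun g hg => hCstore _ _ _ _ (j4 g (h5 g hg)))
      (s.setCell 2 d 0)
      ⟨hstore _ _ _ hs, by simp [State.setCell], fun i hi => by
          have hid : i ≠ d := by omega
          simp [State.setCell, Function.update_of_ne hid],
        fun g _ hg2 hg3 => by
          have := hg2 d (by omega) (by omega)
          push_cast at hg3; omega,
        fun g hg => hCstore _ _ _ _ hg⟩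
    refine ⟨s', _, .seq (.store _ _ _ _) h, ?_, h1, by simpa using h3, ?_, h5⟩
    · simp only [Expr.cost, enumBound] at ht ⊢
      simp
      have : (n + 1) * (1 + 1 + 1 + (1 + 1) + 1 + 1 + (Polynomial.eval n (enumBound B d) + 6))
        = (n + 1) * (Polynomial.eval n (enumBound B d) + 13) := by ring
      omega
    · intro g hg1 hg2
      have := hg2 d (by omega) (by push_cast; omega)
      exact h4 g (by simpa using hg1) (by simpa using hg2) (by push_cast; omega)

end OracleRAM

/-! ### Gaps of numerical semigroups -/

/-- The multiples of the greatest common divisor of the `a i`, `i ∈ I`, that are not nonnegative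
integer combinations of these numbers. -/
def gaps {p : ℕ} (a : Fin p → ℕ) (I : Finset (Fin p)) : Set ℕ :=
  {z | I.gcd a ∣ z ∧ ¬ ∃ ν : Fin p → ℕ, z = ∑ i ∈ I, a i * ν i}

/-- A subsemigroup of the naturals contains all sufficiently large multiples of its gcd. -/
theorem gaps_finite {p : ℕ} (a : Fin p → ℕ) (I : Finset (Fin p)) : (gaps a I).Finite := by
  refine (Nat.finite_setOfPred_setGcd_dvd_and_mem_span (s := a '' I)).subset ?_
  rintro z ⟨hz, hν⟩
  refine ⟨(Finset.dvd_gcd fun i hi =>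
    Nat.setGcd_dvd_of_mem (Set.mem_image_of_mem a hi)).trans hz, fun hmem => hν ?_⟩
  obtain ⟨c, hc⟩ := (Submodule.mem_span_image_finset_iff_exists_fun' ℕ).1 hmem
  exact ⟨c, by rw [← hc]; exact Finset.sum_congr rfl fun i _ => by rw [smul_eq_mul, mul_comm]⟩

/-- A generator dividing all others is itself the gcd, so its multiples exhaust the multiples of the
gcd. -/
theorem gaps_eq_empty {p : ℕ} {a : Fin p → ℕ} {I : Finset (Fin p)}
    (h : I.Nonempty → ∃ i ∈ I, ∀ j ∈ I, a i ∣ a j) : gaps a I = ∅ := by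
  rw [Set.eq_empty_iff_forall_notMem]
  rintro z ⟨hz, hν⟩
  rcases I.eq_empty_or_nonempty with rfl | hI
  -- The gcd of the empty family is 0, which leaves only z = 0, the empty sum.
  · exact hν ⟨0, by simpa using hz⟩
  · obtain ⟨i, hi, hij⟩ := h hI
    obtain ⟨k, rfl⟩ := (Finset.dvd_gcd hij).trans hz
    refine hν ⟨fun j => if j = i then k else 0, ?_⟩
    simp [hi]

theorem IsDivisibleTuple.dvd {p : ℕ} {a : Fin p → ℕ} (h : IsDivisibleTuple a) {i j : Fin p}
    (hij : i ≤ j) : a i ∣ a j := by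
  obtain ⟨j, hj⟩ := j
  induction j with
  | zero =>
    obtain rfl : i = ⟨0, hj⟩ := Fin.ext (by simpa [Fin.le_def] using hij)
    exact dvd_rfl
  | succ j ih =>
    rcases eq_or_lt_of_le hij with rfl | hlt
    · exact dvd_rfl
    · exact (ih (by omega) (Nat.lt_succ_iff.1 hlt)).trans (h ⟨j, by omega⟩ ⟨j + 1, hj⟩ rfl)

theorem IsDivisibleTuple.gaps_eq_empty {p : ℕ} {a : Fin p → ℕ} (h : IsDivisibleTuple a)
    (I : Finset (Fin p)) : gaps a I = ∅ :=
  _root_.gaps_eq_empty fun hI =>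
    ⟨I.min' hI, I.min'_mem hI, fun j hj => h.dvd (I.min'_le j hj)⟩

theorem exists_isFrobeniusNumber {p : ℕ} {a : Fin p → ℕ} (ha : Finset.univ.gcd a = 1) :
    ∃ F, IsFrobeniusNumber a F := by
  obtain ⟨N, hN⟩ := (gaps_finite a Finset.univ).bddAbove
  refine Int.exists_greatest_of_bdd ⟨N, fun z hz => ?_⟩ ⟨-1, ?_⟩
  · rcases lt_or_ge z 0 with h | h
    · omega
    · lift z to ℕ using h
      refine Int.ofNat_le.2 (hN ⟨by simp [ha], ?_⟩)
      rintro ⟨ν, hν⟩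
      exact hz ⟨ν, by rw [hν]; push_cast; exact Finset.sum_congr rfl fun i _ => mul_comm _ _⟩
  · rintro ⟨c, hc⟩
    have : (0 : ℤ) ≤ ∑ i, (c i : ℤ) * (a i : ℤ) := by positivity
    omega

/-- All gaps lie in 1, …, F. For F = -1 the truncation `F.toNat` is 0 and this range is empty. -/
theorem ncard_gaps_univ_le {p : ℕ} {a : Fin p → ℕ} {F : ℤ} (hF : IsFrobeniusNumber a F) :
    (gaps a Finset.univ).ncard ≤ F.toNat := by
  have hsub : gaps a Finset.univ ⊆ Finset.Icc 1 F.toNat := by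
    rintro z ⟨-, hz⟩
    have hzF : (z : ℤ) ≤ F := hF.2 (by
      rintro ⟨c, hc⟩
      refine hz ⟨c, ?_⟩
      zify
      rw [hc]
      exact Finset.sum_congr rfl fun i _ => mul_comm _ _)
    have hz0 : z ≠ 0 := by
      rintro rfl
      exact hz ⟨0, by simp⟩
    simp only [Finset.coe_Icc, Set.mem_Icc]
    omega
  calc (gaps a Finset.univ).ncard ≤ ((Finset.Icc 1 F.toNat : Finset ℕ) : Set ℕ).ncard :=
        Set.ncard_le_ncard hsub (Finset.finite_toSet _)
    _ = F.toNat := by rw [Set.ncard_coe_finset]; simp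

/-- The indices at which a vector with entries bounded by `A` attains the bound. -/
def saturated {p A : ℕ} (τ : Fin p → Fin (A + 1)) : Finset (Fin p) :=
  Finset.univ.filter fun i => (τ i : ℕ) = A

/-- The total number of gaps over all possible patterns of bounded coordinates. -/
noncomputable def totalGaps {p : ℕ} (a : Fin p → ℕ) (A : ℕ) : ℕ :=
  ∑ τ : Fin p → Fin (A + 1), (gaps a (saturated τ)).ncard

theorem IsDivisibleTuple.totalGaps_eq_zero {p : ℕ} {a : Fin p → ℕ} (h : IsDivisibleTuple a)
    (A : ℕ) : totalGaps a A = 0 :=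
  Finset.sum_eq_zero fun τ _ => by rw [h.gaps_eq_empty, Set.ncard_empty]

/-- At most one saturated class generates no gaps, and both classes are saturated for a single
pattern only. -/
theorem totalGaps_le_of_pair {a : Fin 2 → ℕ} {A : ℕ} {F : ℤ} (hF : IsFrobeniusNumber a F) :
    totalGaps a A ≤ F.toNat := by
  rw [totalGaps, Finset.sum_eq_single (fun _ => Fin.last A)]
  · have : saturated (fun _ : Fin 2 => Fin.last A) = Finset.univ := by simp [saturated]
    rw [this]
    exact ncard_gaps_univ_le hF
  · intro τ _ hτ
    rw [gaps_eq_empty, Set.ncard_empty]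
    rintro ⟨i, hi⟩
    refine ⟨i, hi, fun j hj => ?_⟩
    suffices j = i by rw [this]
    by_contra hij
    refine hτ (funext fun k => Fin.ext ?_)
    simp only [saturated, Finset.mem_filter, Finset.mem_univ, true_and] at hi hj
    have : k = i ∨ k = j := by omega
    rcases this with rfl | rfl
    · simpa using hi
    · simpa using hj
  · simp

/-! ### The exchange argument -/

/-- A nonnegative combination that leaves room below `∑ a i * l i` can be rewritten with
coefficients bounded by the `l i`. -/
theorem exists_bounded_combination {p A : ℕ} {a : Fin p → ℕ} {I : Finset (Fin p)}
    (hpos : ∀ i ∈ I, 0 < a i) (hA : ∀ i ∈ I, a i ≤ A) {l l' : Fin p → ℕ}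
    (hl : ∀ i ∈ I, A ≤ l i) (hl' : ∀ i ∈ I, A ≤ l' i) (ν : Fin p → ℕ)
    (h : ∑ i ∈ I, a i * ν i + ∑ i ∈ I, a i * l' i = ∑ i ∈ I, a i * l i) :
    ∃ μ : Fin p → ℕ, (∀ i ∈ I, μ i ≤ l i) ∧ ∑ i ∈ I, a i * μ i = ∑ i ∈ I, a i * ν i := by
  induction hN : ∑ i ∈ I, (ν i - l i) using Nat.strong_induction_on generalizing ν with
  | _ N ih =>
    by_cases hle : ∀ i ∈ I, ν i ≤ l i
    · exact ⟨ν, hle, rfl⟩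
    push Not at hle
    obtain ⟨i, hi, hil⟩ := hle
    -- Otherwise ν k + l' k ≥ ν k + A > l k for all k in I, against the equality `h`.
    obtain ⟨j, hj, hjl⟩ : ∃ j ∈ I, ν j + A ≤ l j := by
      by_contra! hcon
      have : ∑ i ∈ I, a i * l i < ∑ i ∈ I, a i * (ν i + l' i) :=
        Finset.sum_lt_sum_of_nonempty ⟨i, hi⟩ fun k hk =>
          Nat.mul_lt_mul_of_pos_left ((hcon k hk).trans_le (by have := hl' k hk; omega)) (hpos k hk)
      simp only [mul_add, Finset.sum_add_distrib] at this
      omega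
    have hij : i ≠ j := by
      rintro rfl
      omega
    have hai := hA i hi
    have haj := hA j hj
    have hli := hl i hi
    have h0i := hpos i hi
    have h0j := hpos j hj
    -- Trading a j copies of a i for a i copies of a j keeps the value. It is possible since ν i > l
    -- i ≥ A ≥ a j, and creates no excess at j since ν j + a i ≤ l j; so the total excess over l
    -- drops.
    set ν' : Fin p → ℕ := Function.update (Function.update ν i (ν i - a j)) j (ν j + a i) with hν'
    have hi' : ν' i = ν i - a j := by simp [hν', hij]
    have hj' : ν' j = ν j + a i := by simp [hν']
    have hk' : ∀ k, k ≠ i → k ≠ j → ν' k = ν k := fun k h1 h2 => by simp [hν', h1, h2]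
    have hjI : j ∈ I.erase i := Finset.mem_erase.2 ⟨hij.symm, hj⟩
    have hsum : ∑ k ∈ I, a k * ν' k = ∑ k ∈ I, a k * ν k := by
      rw [← Finset.add_sum_erase I _ hi, ← Finset.add_sum_erase _ _ hjI,
        ← Finset.add_sum_erase I (fun k => a k * ν k) hi,
        ← Finset.add_sum_erase _ (fun k => a k * ν k) hjI, hi', hj']
      have : ∑ k ∈ (I.erase i).erase j, a k * ν' k = ∑ k ∈ (I.erase i).erase j, a k * ν k :=
        Finset.sum_congr rfl fun k hk => by
          simp only [Finset.mem_erase] at hk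
          rw [hk' k hk.2.1 hk.1]
      rw [this]
      obtain ⟨d, hd⟩ := Nat.exists_eq_add_of_le (show a j ≤ ν i by omega)
      rw [hd, Nat.add_sub_cancel_left]
      ring
    obtain ⟨μ, h1, h2⟩ := ih (∑ k ∈ I, (ν' k - l k)) (by
      rw [← hN]
      refine Finset.sum_lt_sum (fun k hk => ?_) ⟨i, hi, by omega⟩
      by_cases hki : k = i
      · subst hki; omega
      by_cases hkj : k = j
      · subst hkj; omega
      rw [hk' k hki hkj]) ν' (by rw [hsum, h]) rfl
    exact ⟨μ, h1, h2.trans hsum⟩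

/-! ### Selections of coordinates -/

/-- A discrete intermediate value argument: raising the threshold by 1 adds at most one element. -/
theorem exists_card_filter_lt_eq {n k : ℕ} (s : Finset (Fin n)) (hk : k ≤ s.card) :
    ∃ t ≤ n, (s.filter fun j : Fin n => (j : ℕ) < t).card = k := by
  suffices H : ∀ m, k ≤ (s.filter fun j : Fin n => (j : ℕ) < m).card →
      ∃ t ≤ m, (s.filter fun j : Fin n => (j : ℕ) < t).card = k from
    H n (by rwa [Finset.filter_true_of_mem fun j _ => j.2])
  intro m
  induction m with
  | zero => exact fun h => ⟨0, le_rfl, by simp at h ⊢; exact h.symm⟩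
  | succ m ih =>
    intro h
    rcases le_or_gt k (s.filter fun j : Fin n => (j : ℕ) < m).card with h' | h'
    · obtain ⟨t, ht, h⟩ := ih h'
      exact ⟨t, by omega, h⟩
    · refine ⟨m + 1, le_rfl, le_antisymm ?_ h⟩
      have hsub : (s.filter fun j : Fin n => (j : ℕ) < m + 1) ⊆
          (s.filter fun j : Fin n => (j : ℕ) < m) ∪ (Finset.univ.filter fun j : Fin n => (j : ℕ) = m) := by
        intro j
        simp only [Finset.mem_union, Finset.mem_filter, Finset.mem_univ, true_and]
        rintro ⟨h1, h2⟩
        rcases Nat.lt_succ_iff_lt_or_eq.1 h2 with h3 | h3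
        · exact .inl ⟨h1, h3⟩
        · exact .inr h3
      have h1 : (Finset.univ.filter fun j : Fin n => (j : ℕ) = m).card ≤ 1 :=
        Finset.card_le_one.2 fun x hx y hy => Fin.ext (by simp at hx hy; omega)
      have := (Finset.card_le_card hsub).trans (Finset.card_union_le _ _)
      omega

theorem exists_listing {n : ℕ} (K : ℕ) (J : Finset (Fin n)) (hJ : J.card ≤ K) :
    ∃ e : ℕ → ℕ, (∀ l, e l ≤ n) ∧ ∀ (M : ℤ) (j : Fin n),
      (∑ l ∈ Finset.range K, if (e l : ℤ) = (j : ℕ) then M else 0) = if j ∈ J then M else 0 := by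
  induction K generalizing J with
  | zero =>
    obtain rfl : J = ∅ := by simpa using hJ
    exact ⟨fun _ => n, fun _ => le_rfl, by simp⟩
  | succ K ih =>
    rcases J.eq_empty_or_nonempty with rfl | ⟨i, hi⟩
    -- The number n is an admissible cell value but names no coordinate, so it serves as padding.
    · refine ⟨fun _ => n, fun _ => le_rfl, fun M j => ?_⟩
      rw [if_neg (by simp)]
      exact Finset.sum_eq_zero fun l _ => if_neg (by have := j.2; dsimp only; omega)
    · obtain ⟨e, he, hs⟩ := ih (J.erase i) (by rw [Finset.card_erase_of_mem hi]; omega)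
      refine ⟨fun l => if l = K then i else e l, fun l => ?_, fun M j => ?_⟩
      · dsimp only
        split_ifs
        exacts [i.2.le, he l]
      · simp only [Finset.sum_range_succ, if_true]
        have : (∑ l ∈ Finset.range K, if (((if l = K then (i : ℕ) else e l) : ℕ) : ℤ) = (j : ℕ)
            then M else 0) = if j ∈ J.erase i then M else 0 := by
          rw [← hs M j]
          exact Finset.sum_congr rfl fun l hl => by
            rw [if_neg (Finset.mem_range.1 hl).ne]
        rw [this]
        by_cases hij : j = i
        · subst hij; simp [hi]
        · simp [hij, Ne.symm hij, Fin.val_inj]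

/-- The number of elements of class `i` in the support of `x`. -/
def classCount {n p : ℕ} (κ : Fin n → Fin p) (x : Fin n → ℤ) (i : Fin p) : ℕ :=
  (Finset.univ.filter fun j => κ j = i ∧ 0 < x j).card

theorem sum_mul_classCount {n p : ℕ} {κ : Fin n → Fin p} {x : Fin n → ℤ} (hx : IsZeroOne x)
    (b : Fin p → ℤ) (I : Finset (Fin p)) :
    ∑ i ∈ I, b i * (classCount κ x i : ℤ) = ∑ j, (if κ j ∈ I then b (κ j) else 0) * x j := by
  have h1 : ∀ i, b i * (classCount κ x i : ℤ) = ∑ j, if κ j = i then b i * x j else 0 := by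
    intro i
    rw [classCount, Finset.card_filter]
    push_cast
    rw [Finset.mul_sum]
    refine Finset.sum_congr rfl fun j _ => ?_
    rcases hx j with h | h <;> by_cases hk : κ j = i <;> simp [h, hk]
  simp only [h1]
  rw [Finset.sum_comm]
  refine Finset.sum_congr rfl fun j _ => ?_
  rw [Finset.sum_ite_eq]
  split_ifs <;> simp

theorem dotProduct_eq_sum_classCount {n p : ℕ} {a : Fin p → ℕ} {κ : Fin n → Fin p}
    {x w : Fin n → ℤ} (hx : IsZeroOne x) (hw : ∀ j, w j = a (κ j)) :
    w ⬝ᵥ x = ∑ i, (a i : ℤ) * classCount κ x i := by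
  rw [sum_mul_classCount hx]
  simp [dotProduct, hw]

open OracleRAM

/-! ### Good contents of the guessed array -/

/-- `g` has values in `0, …, n` at the arguments `0, …, D - 1`, and vanishes elsewhere. -/
def IsGuess (n D : ℕ) (g : ℤ → ℤ) : Prop :=
  (∀ i : ℤ, ¬ (0 ≤ i ∧ i < D) → g i = 0) ∧ ∀ i : ℤ, 0 ≤ i → i < D → 0 ≤ g i ∧ g i ≤ n

theorem extend_le {p n : ℕ} (a : Fin p → ℕ) {h : Fin p → ℕ} (hh : ∀ i, h i ≤ n) (v : ℕ) :
    Function.extend a h 0 v ≤ n := by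
  classical
  rw [Function.extend_def]
  split_ifs
  exacts [hh _, Nat.zero_le _]

theorem exists_isGuess {p n A K : ℕ} {a : Fin p → ℕ} (ha : Function.Injective a)
    (hA : ∀ i, a i ≤ A) {h θ : Fin p → ℕ} (hh : ∀ i, h i ≤ n) (hθ : ∀ i, θ i ≤ n) {e : ℕ → ℕ}
    (he : ∀ l, e l ≤ n) :
    ∃ g, IsGuess n (2 * (A + 1) + K) g ∧ (∀ i, g (a i) = h i) ∧
      (∀ i, g (a i + (A + 1 : ℕ)) = θ i) ∧ ∀ l < K, g ((2 * (A + 1) : ℕ) + l) = e l := by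
  -- Three blocks: class selection and thresholds, both indexed by the weight a i ≤ A rather than by
  -- i, then the list of forced coordinates.
  let G : ℕ → ℕ := fun v =>
    if v < A + 1 then Function.extend a h 0 v
    else if v < 2 * (A + 1) then Function.extend a θ 0 (v - (A + 1))
    else if v < 2 * (A + 1) + K then e (v - 2 * (A + 1)) else 0
  have hG : ∀ v, G v ≤ n := by
    intro v
    simp only [G]
    split_ifs
    exacts [extend_le a hh _, extend_le a hθ _, he _, Nat.zero_le _]
  let g : ℤ → ℤ := fun z => if 0 ≤ z then (G z.toNat : ℤ) else 0
  have hg : ∀ v : ℕ, g v = G v := fun v => by simp [g]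
  refine ⟨g, ⟨fun z hz => ?_, fun z hz _ => ?_⟩, fun i => ?_, fun i => ?_, fun l hl => ?_⟩
  · by_cases h0 : 0 ≤ z
    · lift z to ℕ using h0
      have h1 : 2 * (A + 1) + K ≤ z := by omega
      rw [hg]
      simp only [G]
      rw [if_neg (by omega), if_neg (by omega), if_neg (by omega), Nat.cast_zero]
    · exact if_neg h0
  · lift z to ℕ using hz
    rw [hg]
    exact ⟨Int.natCast_nonneg _, Int.ofNat_le.2 (hG z)⟩
  · rw [hg]
    simp only [G]
    rw [if_pos (Nat.lt_succ_of_le (hA i)), ha.extend_apply]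
  · rw [← Nat.cast_add, hg]
    simp only [G]
    have := hA i
    rw [if_neg (by omega), if_pos (by omega), Nat.add_sub_cancel, ha.extend_apply]
  · rw [← Nat.cast_add, hg]
    simp only [G]
    rw [if_neg (by omega), if_neg (by omega), if_pos (by omega), Nat.add_sub_cancel_left]

/-! ### Optima with forced coordinates -/

/-- The total weight in the classes of I is at most A * n, so losing a single bonus A * n + 1 cannot
be compensated. Once all bonuses are collected, they cancel in the comparison with y. -/
theorem mem_optimum_of_forced {n p A : ℕ} {S : Set (Fin n → ℤ)} (hS : IsIndependenceSystem S)
    {a : Fin p → ℕ} (hA : ∀ i, a i ≤ A) {κ : Fin n → Fin p} {I : Finset (Fin p)}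
    {J : Finset (Fin n)} {c x y : Fin n → ℤ}
    (hc : ∀ j, c j = (if κ j ∈ I then (a (κ j) : ℤ) else 0) + if j ∈ J then (A * n + 1 : ℤ) else 0)
    (hx : x ∈ S) (hmax : ∀ z ∈ S, c ⬝ᵥ z ≤ c ⬝ᵥ x) (hy : y ∈ S) (hJ : ∀ j ∈ J, 0 < y j) :
    (∀ j ∈ J, 0 < x j) ∧
      ∑ i ∈ I, a i * classCount κ y i ≤ ∑ i ∈ I, a i * classCount κ x i := by
  have key : ∀ z ∈ S, c ⬝ᵥ z =
      ∑ i ∈ I, (a i : ℤ) * classCount κ z i + (A * n + 1) * ∑ j ∈ J, z j := by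
    intro z hz
    have hJz : ∑ j ∈ J, z j = ∑ j, if j ∈ J then z j else 0 := by simp
    rw [sum_mul_classCount (hS.zeroOne z hz) (fun i => (a i : ℤ)), hJz, Finset.mul_sum,
      ← Finset.sum_add_distrib, dotProduct]
    refine Finset.sum_congr rfl fun j _ => ?_
    rw [hc j]
    split_ifs <;> ring
  have hle := hmax y hy
  rw [key x hx, key y hy] at hle
  have hxle : ∑ i ∈ I, (a i : ℤ) * classCount κ x i ≤ A * n := by
    rw [sum_mul_classCount (hS.zeroOne x hx) (fun i => (a i : ℤ))]
    calc _ ≤ ∑ _j : Fin n, (A : ℤ) := by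
          refine Finset.sum_le_sum fun j _ => ?_
          have := hA (κ j)
          rcases hS.zeroOne x hx j with h | h <;> split_ifs <;> simp [h, this]
      _ = A * n := by simp [mul_comm]
  have hy0 : 0 ≤ ∑ i ∈ I, (a i : ℤ) * classCount κ y i := by positivity
  have hy1 : ∀ j ∈ J, y j = 1 := fun j hj => by
    have := hJ j hj
    rcases hS.zeroOne y hy j with h | h <;> omega
  have hxy : ∀ j ∈ J, x j ≤ y j := fun j hj => by
    rw [hy1 j hj]
    rcases hS.zeroOne x hx j with h | h <;> omega
  have hsupp : ∀ j ∈ J, 0 < x j := by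
    intro j hj
    by_contra hneg
    have hlt : ∑ j ∈ J, x j < ∑ j ∈ J, y j :=
      Finset.sum_lt_sum hxy ⟨j, hj, by have := hJ j hj; omega⟩
    have hM : (0 : ℤ) ≤ A * n + 1 := by positivity
    have := mul_le_mul_of_nonneg_left (Int.add_one_le_of_lt hlt) hM
    rw [mul_add] at this
    omega
  refine ⟨hsupp, ?_⟩
  have heq : ∑ j ∈ J, x j = ∑ j ∈ J, y j := Finset.sum_congr rfl fun j hj => by
    have := hsupp j hj
    have := hxy j hj
    have := hy1 j hj
    omega
  rw [heq] at hle
  zify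
  linarith

theorem cut_mem {n A : ℕ} {S : Set (Fin n → ℤ)} (hS : IsIndependenceSystem S) {x : Fin n → ℤ}
    (hx : x ∈ S) (w : Fin n → ℤ) (g : ℤ → ℤ) : cut A w g x ∈ S := by
  refine hS.down_closed _ x (fun j => ?_) (fun j => ?_) hx
  · unfold cut
    split_ifs <;> simp
  · unfold cut
    split_ifs with h
    · exact h.1
    · rcases hS.zeroOne x hx j with h | h <;> simp [h]

theorem candidate_mem {n A K : ℕ} {S : Set (Fin n → ℤ)} (hS : IsIndependenceSystem S)
    {O : Oracles n} (hO : IsLinearOptimizationOracle S O.linOpt) (w : Fin n → ℤ) (g : ℤ → ℤ) :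
    candidate O A K w g ∈ S :=
  cut_mem hS (hO _).1 w g

/-- The point x comes from the query for I and J alone. The query does not read the thresholds, so
these can be adapted to x afterwards. -/
theorem exists_isGuess_dotProduct_eq {n p A K : ℕ} {S : Set (Fin n → ℤ)}
    (hS : IsIndependenceSystem S) {a : Fin p → ℕ} (ha : Function.Injective a)
    (hA : ∀ i, a i ≤ A) {κ : Fin n → Fin p} {w : Fin n → ℤ} (hw : ∀ j, w j = a (κ j))
    {O : Oracles n} (hO : IsLinearOptimizationOracle S O.linOpt) (I : Finset (Fin p))
    {J : Finset (Fin n)} (hJ : J.card ≤ K) :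
    ∃ x ∈ S,
      (∀ y ∈ S, (∀ j ∈ J, 0 < y j) → (∀ j ∈ J, 0 < x j) ∧
        ∑ i ∈ I, a i * classCount κ y i ≤ ∑ i ∈ I, a i * classCount κ x i) ∧
      ∀ μ : Fin p → ℕ, (∀ i, μ i ≤ classCount κ x i) →
        ∃ g, IsGuess n (2 * (A + 1) + K) g ∧
          w ⬝ᵥ candidate O A K w g = ∑ i, (a i : ℤ) * μ i := by
  classical
  obtain ⟨e, he, hsum⟩ := exists_listing K J hJ
  set c : Fin n → ℤ := fun j =>
    (if κ j ∈ I then (a (κ j) : ℤ) else 0) + if j ∈ J then (A * n + 1 : ℤ) else 0 with hc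
  refine ⟨O.linOpt c, (hO c).1, fun y hy hyJ =>
    mem_optimum_of_forced hS hA (fun _ => rfl) (hO c).1 (hO c).2 hy hyJ, fun μ hμ => ?_⟩
  choose θ hθ hcard using fun i => exists_card_filter_lt_eq _ (hμ i)
  obtain ⟨g, hg, hgI, hgθ, hge⟩ := exists_isGuess (n := n) (A := A) (K := K) ha hA
    -- Any positive entry selects a class; n is positive as soon as there is a coordinate.
    (h := fun i => if i ∈ I then n else 0) (by intro i; split_ifs <;> simp) hθ he
  refine ⟨g, hg, ?_⟩
  have hquery : query A K w g = c := by
    funext j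
    have hn : 0 < n := j.pos
    have hgj : (0 < g (w j)) ↔ κ j ∈ I := by
      rw [hw, hgI]
      split_ifs with h <;> simp [h, hn]
    have hs : (∑ l ∈ Finset.range K, if g ((2 * (A + 1) : ℕ) + l) = (j : ℕ)
        then (A * n + 1 : ℤ) else 0) = if j ∈ J then (A * n + 1 : ℤ) else 0 := by
      rw [← hsum]
      exact Finset.sum_congr rfl fun l hl => by rw [hge l (Finset.mem_range.1 hl)]
    rw [query, hs, hc]
    simp only [hgj]
    split_ifs <;> simp [hw]
  have hmem := candidate_mem (A := A) (K := K) hS hO w g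
  rw [dotProduct_eq_sum_classCount (hS.zeroOne _ hmem) hw]
  refine Finset.sum_congr rfl fun i _ => ?_
  congr 2
  rw [← hcard i, classCount, Finset.filter_filter]
  congr 1
  ext j
  simp only [Finset.mem_filter, Finset.mem_univ, true_and, candidate, hquery, cut, and_assoc]
  refine and_congr_right fun hj => ?_
  rw [hw, hgθ, hj]
  split_ifs with h
  · simp only [zero_lt_one, true_iff]
    exact ⟨h.1, by omega⟩
  · simp only [lt_self_iff_false, false_iff]
    rintro ⟨h1, h2⟩
    exact h ⟨h1, by omega⟩

/-- Forcing these elements guarantees the class counts τ. Truncation at A bounds their number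
independently of n, which keeps the enumeration polynomial. -/
theorem exists_subset_classCount {n p A : ℕ} {κ : Fin n → Fin p} {y : Fin n → ℤ}
    (τ : Fin p → ℕ) (hτA : ∀ i, τ i ≤ A) (hτ : ∀ i, τ i ≤ classCount κ y i) :
    ∃ J : Finset (Fin n), J.card ≤ p * A ∧ (∀ j ∈ J, 0 < y j) ∧
      ∀ x : Fin n → ℤ, (∀ j ∈ J, 0 < x j) → ∀ i, τ i ≤ classCount κ x i := by
  classical
  choose J hJ hcard using fun i => Finset.exists_subset_card_eq (hτ i)
  refine ⟨Finset.univ.biUnion J, ?_, fun j hj => ?_, fun x hx i => ?_⟩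
  · calc _ ≤ ∑ i, (J i).card := Finset.card_biUnion_le
      _ ≤ ∑ _i : Fin p, A := Finset.sum_le_sum fun i _ => (hcard i).trans_le (hτA i)
      _ = p * A := by simp
  · obtain ⟨i, -, hi⟩ := Finset.mem_biUnion.1 hj
    exact (Finset.mem_filter.1 (hJ i hi)).2.2
  · rw [← hcard i]
    refine Finset.card_le_card fun j hj => Finset.mem_filter.2 ⟨Finset.mem_univ j, ?_, ?_⟩
    · exact (Finset.mem_filter.1 (hJ i hj)).2.1
    · exact hx j (Finset.mem_biUnion.2 ⟨i, Finset.mem_univ i, hj⟩)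

/-! ### Values missed by the candidates -/

/-- Every feasible value with a given pattern of bounded class counts is the value of a candidate,
or differs by a gap from a number that depends only on the pattern. -/
theorem exists_isGuess_or_gap {n p A : ℕ} {S : Set (Fin n → ℤ)}
    (hS : IsIndependenceSystem S) {a : Fin p → ℕ} (hpos : ∀ i, 0 < a i)
    (ha : Function.Injective a) (hA : ∀ i, a i ≤ A) {κ : Fin n → Fin p} {w : Fin n → ℤ}
    (hw : ∀ j, w j = a (κ j)) {O : Oracles n} (hO : IsLinearOptimizationOracle S O.linOpt)
    (τ : Fin p → Fin (A + 1)) :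
    ∃ v : ℤ, ∀ y ∈ S, (∀ i, (τ i : ℕ) = min (classCount κ y i) A) →
      (∃ g, IsGuess n (2 * (A + 1) + p * A) g ∧ w ⬝ᵥ y = w ⬝ᵥ candidate O A (p * A) w g) ∨
      ∃ γ ∈ gaps a (saturated τ), w ⬝ᵥ y = v - (γ : ℤ) := by
  classical
  set I := saturated τ with hI
  let W : (Fin n → ℤ) → ℕ := fun y => ∑ i ∈ I, a i * classCount κ y i
  let N : Set ℕ := W '' {y | y ∈ S ∧ ∀ i, (τ i : ℕ) = min (classCount κ y i) A}
  by_cases hN : N.Nonempty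
  swap
  · exact ⟨0, fun y hy hτ => (hN ⟨_, y, ⟨hy, hτ⟩, rfl⟩).elim⟩
  have hbdd : BddAbove N := by
    refine ⟨∑ i ∈ I, a i * n, ?_⟩
    rintro _ ⟨y, -, rfl⟩
    refine Finset.sum_le_sum fun i _ => Nat.mul_le_mul_left _ ?_
    exact (Finset.card_le_univ _).trans_eq (Fintype.card_fin n)
  -- Since y₀ is chosen from the pattern alone, J, x and the number v below serve all y of this
  -- pattern.
  obtain ⟨y₀, ⟨hy₀, hτ₀⟩, hmax₀⟩ := Nat.sSup_mem hN hbdd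
  obtain ⟨J, hJ, hJy₀, hJx⟩ := exists_subset_classCount (A := A) (κ := κ) (y := y₀)
    (fun i => (τ i : ℕ)) (fun i => Nat.lt_succ_iff.1 (τ i).2)
    (fun i => by rw [hτ₀ i]; exact min_le_left _ _)
  obtain ⟨x, hx, hxmax, hxg⟩ := exists_isGuess_dotProduct_eq hS ha hA hw hO I hJ
  obtain ⟨hJx', hWx⟩ := hxmax y₀ hy₀ hJy₀
  have hτx := hJx x hJx'
  refine ⟨∑ i ∈ Iᶜ, (a i : ℤ) * (τ i : ℕ) + W x, fun y hy hτ => ?_⟩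
  have hWyx : W y ≤ W x := (le_csSup hbdd ⟨y, ⟨hy, hτ⟩, rfl⟩).trans (hmax₀.ge.trans hWx)
  have hmemI : ∀ i, i ∈ I ↔ (τ i : ℕ) = A := fun i => by simp [hI, saturated]
  have hlarge : ∀ i ∈ I, A ≤ classCount κ y i := fun i hi => by
    have := hτ i
    rw [(hmemI i).1 hi] at this
    omega
  have hsmall : ∀ i ∈ Iᶜ, classCount κ y i = τ i := fun i hi => by
    have h1 := hτ i
    have h2 : (τ i : ℕ) ≠ A := fun h => (Finset.mem_compl.1 hi) ((hmemI i).2 h)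
    omega
  have hvalue : w ⬝ᵥ y = ∑ i ∈ Iᶜ, (a i : ℤ) * (τ i : ℕ) + W y := by
    rw [dotProduct_eq_sum_classCount (hS.zeroOne y hy) hw, ← Finset.sum_compl_add_sum I,
      Finset.sum_congr rfl fun i hi => by rw [hsmall i hi]]
    simp [W]
  obtain ⟨z, hz⟩ := Nat.exists_eq_add_of_le hWyx
  have hdvd : ∀ u, I.gcd a ∣ W u := fun u =>
    Finset.dvd_sum fun i hi => (Finset.gcd_dvd hi).mul_right _
  have hzdvd : I.gcd a ∣ z := (Nat.dvd_add_right (hdvd y)).1 (hz ▸ hdvd x)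
  by_cases hrep : ∃ ν : Fin p → ℕ, z = ∑ i ∈ I, a i * ν i
  swap
  · refine .inr ⟨z, ⟨hzdvd, hrep⟩, ?_⟩
    rw [hvalue, hz]
    push_cast
    ring
  left
  obtain ⟨ν, rfl⟩ := hrep
  -- Room for the exchange: what remains of W x after subtracting z is W y, whose counts on I are at
  -- least A.
  obtain ⟨ν', hν', hsum⟩ := exists_bounded_combination (A := A) (l := classCount κ x)
    (l' := classCount κ y) (fun i _ => hpos i) (fun i _ => hA i)
    (fun i hi => ((hmemI i).1 hi).ge.trans (hτx i)) hlarge ν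
    ((add_comm _ _).trans hz.symm)
  -- Inside I the surplus ν' is deleted from x; outside I the counts are cut down to those of y.
  obtain ⟨g, hg, hgv⟩ := hxg (fun i => if i ∈ I then classCount κ x i - ν' i else τ i) (by
    intro i
    split_ifs
    exacts [Nat.sub_le _ _, hτx i])
  refine ⟨g, hg, ?_⟩
  rw [hgv, hvalue, ← Finset.sum_compl_add_sum I]
  congr 1
  · refine Finset.sum_congr rfl fun i hi => ?_
    rw [if_neg (Finset.mem_compl.1 hi)]
  · have h1 : ∑ i ∈ I, (a i : ℤ) * ((if i ∈ I then classCount κ x i - ν' i else τ i : ℕ) : ℤ) =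
        ∑ i ∈ I, ((a i : ℤ) * classCount κ x i - (a i : ℤ) * ν' i) :=
      Finset.sum_congr rfl fun i hi => by
        rw [if_pos hi, Nat.cast_sub (hν' i hi)]
        ring
    rw [h1, Finset.sum_sub_distrib]
    have h2 : (W x : ℤ) = ∑ i ∈ I, (a i : ℤ) * classCount κ x i := by simp [W]
    have h3 : ∑ i ∈ I, (a i : ℤ) * (ν' i : ℤ) = ((∑ i ∈ I, a i * ν i : ℕ) : ℤ) := by
      rw [← hsum]
      push_cast
      rfl
    rw [← h2, h3, hz]
    push_cast
    ring

/-- A feasible point that is at least as good as all candidates is best up to the gaps. -/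
theorem isBestSolution_of_le_candidate {n p A : ℕ} {S : Set (Fin n → ℤ)}
    (hS : IsIndependenceSystem S) {a : Fin p → ℕ} (hpos : ∀ i, 0 < a i)
    (ha : Function.Injective a) (hA : ∀ i, a i ≤ A) {w : Fin n → ℤ}
    (hw : ∀ j, ∃ i, w j = a i) {O : Oracles n} (hO : IsLinearOptimizationOracle S O.linOpt)
    {f : ℤ → ℝ} {x : Fin n → ℤ} (hx : x ∈ S)
    (hbest : ∀ g, IsGuess n (2 * (A + 1) + p * A) g →
      f (w ⬝ᵥ x) ≤ f (w ⬝ᵥ candidate O A (p * A) w g)) :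
    IsBestSolution S w f (totalGaps a A) x := by
  classical
  choose κ hκ using hw
  choose v hv using exists_isGuess_or_gap hS hpos ha hA hκ hO
  -- The exceptional objective values: one for each pattern and each of its gaps.
  let B : Finset ℝ := Finset.univ.biUnion fun τ : Fin p → Fin (A + 1) =>
    (gaps_finite a (saturated τ)).toFinset.image fun γ : ℕ => f (v τ - (γ : ℤ))
  have hB : B.card ≤ totalGaps a A :=
    Finset.card_biUnion_le.trans (Finset.sum_le_sum fun τ _ => by
      rw [Set.ncard_eq_toFinset_card _ (gaps_finite a (saturated τ))]
      exact Finset.card_image_le)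
  refine ⟨hx, ?_⟩
  calc _ ≤ (B : Set ℝ).encard := by
        refine Set.encard_le_encard ?_
        rintro _ ⟨hlt, y, hy, rfl⟩
        rcases hv (fun i => ⟨min (classCount κ y i) A, by omega⟩) y hy fun i => rfl with
          ⟨g, hg, hgy⟩ | ⟨γ, hγ, hγy⟩
        · rw [hgy] at hlt
          exact absurd hlt (hbest g hg).not_gt
        · refine Finset.mem_coe.2 (Finset.mem_biUnion.2 ⟨_, Finset.mem_univ _,
            Finset.mem_image.2 ⟨γ, (Set.Finite.mem_toFinset _).2 hγ, ?_⟩⟩)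
          rw [hγy]
    _ = B.card := Set.encard_coe_eq_coe_finsetCard B
    _ ≤ totalGaps a A := by exact_mod_cast hB

theorem IsBestSolution.mono {n : ℕ} {S : Set (Fin n → ℤ)} {w : Fin n → ℤ} {f : ℤ → ℝ}
    {r r' : ℕ} {x : Fin n → ℤ} (h : IsBestSolution S w f r x) (hr : r ≤ r') :
    IsBestSolution S w f r' x :=
  ⟨h.1, h.2.trans (by exact_mod_cast hr)⟩

/-! ### The algorithm and its guarantees -/

/-- A bound for the running time of the algorithm. -/
noncomputable def timeBound (A K : ℕ) : Polynomial ℕ :=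
  enumBound (.X * 60 + .C (K * (2 * A + 8) + 29)) (2 * (A + 1) + K)

theorem exec_enum_tryCmd {n A K : ℕ} {S : Set (Fin n → ℤ)} (hS : IsIndependenceSystem S)
    {w : Fin n → ℤ} {f : ℤ → ℝ} {O : Oracles n} (hO : IsLinearOptimizationOracle S O.linOpt)
    (hcmp : IsComparisonOracle f O.cmp) :
    ∃ s t, Exec O (enum (tryCmd A K) (2 * (A + 1) + K)) (input w) s t ∧
      t ≤ (timeBound A K).eval n ∧ output n s ∈ S ∧
      ∀ g, IsGuess n (2 * (A + 1) + K) g →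
        f (w ⬝ᵥ output n s) ≤ f (w ⬝ᵥ candidate O A K w g) := by
  have hzero : (0 : Fin n → ℤ) ∈ S := by
    obtain ⟨y, hy⟩ := hS.nonempty
    refine hS.down_closed 0 y (fun _ => .inl rfl) (fun j => ?_) hy
    rcases hS.zeroOne y hy j with h | h <;> simp [h]
  have hout : output n (input w) = 0 := by
    funext j
    simp [output, State.getVec, input]
  obtain ⟨s, t, hexec, ht, ⟨-, -, hmem, hval⟩, -, hcov, -⟩ := exec_enum (O := O)
    (c := tryCmd A K) (B := .X * 60 + .C (K * (2 * A + 8) + 29))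
    (fun s => s.var 0 = n ∧ s.getVec 0 n = w ∧ output n s ∈ S ∧ s.var 4 = w ⬝ᵥ output n s)
    (fun g s => f (s.var 4) ≤ f (w ⬝ᵥ candidate O A K w g))
    (fun s h => h.1) (fun s i z h => h) (fun g s i z h => h)
    (by
      rintro s ⟨h0, hw, hmem, hval⟩
      obtain ⟨s', t, he, ht, h0', hw', h2, hcase⟩ := exec_tryCmd (O := O) A K s h0 w hw
      refine ⟨s', t, he, by simp; omega, ?_⟩
      rcases hcase with ⟨hc, hv, ho⟩ | ⟨hc, hv, ho⟩
      · exact ⟨⟨h0', hw', by rwa [ho], by rw [hv, ho, hval]⟩, h2,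
          by rw [hv]; exact (hcmp _ _).1 hc, fun g hg => by rwa [hv]⟩
      · refine ⟨⟨h0', hw', by rw [ho]; exact candidate_mem hS hO w _, by rw [hv, ho]⟩, h2,
          by rw [hv], fun g hg => ?_⟩
        rw [hv]
        exact (lt_of_not_ge fun h => hc ((hcmp _ _).2 h)).le.trans hg)
    (2 * (A + 1) + K) (input w)
    -- The zeroed memory already stores a feasible best-known point: the zero vector with its weight
    -- 0.
    ⟨rfl, by funext j; simp [State.getVec, input, overwrite_coe], by rwa [hout], by rw [hout]; simp [input]⟩
  refine ⟨s, t, hexec, ht, hmem, fun g hg => ?_⟩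
  rw [← hval]
  exact hcov g (fun i hi => hg.1 i hi) hg.2

theorem mainTheorem7 {p : ℕ} (a : Fin p → ℕ) (ha : IsPrimitiveTuple a) :
    ∃ (r : ℕ) (P : OracleRAM.Cmd) (T : Polynomial ℕ),
      ∀ (n : ℕ) (S : Set (Fin n → ℤ)) (w : Fin n → ℤ) (f : ℤ → ℝ) (O : OracleRAM.Oracles n),
        IsIndependenceSystem S →
        (∀ j, ∃ i, w j = (a i : ℤ)) →
        IsLinearOptimizationOracle S O.linOpt →
        IsComparisonOracle f O.cmp →
        ∃ (s : OracleRAM.State) (t : ℕ),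
          OracleRAM.Exec O P (OracleRAM.input w) s t ∧
          t ≤ T.eval n ∧
          IsBestSolution S w f r (OracleRAM.output n s) ∧
          (IsDivisibleTuple a → IsBestSolution S w f 0 (OracleRAM.output n s)) ∧
          (p = 2 → ∃ F : ℤ, IsFrobeniusNumber a F ∧
            IsBestSolution S w f F.toNat (OracleRAM.output n s)) := by
  set A := Finset.univ.sup a with hA
  refine ⟨totalGaps a A, enum (tryCmd A (p * A)) (2 * (A + 1) + p * A), timeBound A (p * A),
    fun n S w f O hS hw hO hcmp => ?_⟩
  obtain ⟨s, t, hexec, ht, hmem, hbest⟩ := exec_enum_tryCmd (A := A) (K := p * A) (w := w)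
    hS hO hcmp
  have hsol := isBestSolution_of_le_candidate hS ha.pos ha.injective
    (fun i => Finset.le_sup (Finset.mem_univ i)) hw hO hmem hbest
  -- The output is the same in all three claims; only the estimate of the number of gaps changes.
  refine ⟨s, t, hexec, ht, hsol, fun h => hsol.mono (h.totalGaps_eq_zero A).le, ?_⟩
  rintro rfl
  obtain ⟨F, hF⟩ := exists_isFrobeniusNumber ha.gcd_eq_one
  exact ⟨F, hF, hsol.mono (totalGaps_le_of_pair hF)⟩
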